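/- Let $X$ be a compact Hausdorff space. Then $X$ is countable if and only if it has countable scattered height and an $\omega^\omega$-base. Moreover, if $X$ is countable then it is metrizable (so a compact Hausdorff space with countable scattered height and an $\omega^\omega$-base is countable and metrizable). Here "countable" includes finite. For a subspace $A\subseteq X$ let $A'$ be the set of non-isolated points of $A$; put $X^{(0)}=X$ and $X^{(\alpha)}=\bigcap_{\beta<\alpha}(X^{(\beta)})'$ for ordinals $\alpha>0$. The space $X$ is scattered if every nonempty subspace of $X$ has an isolated point; in that case each $x\in X$ has a unique height $h(x)$, the ordinal with $x\in X^{(h(x))}\setminus X^{(h(x)+1)}$, and the scattered height of $X$ is $h(X)=\sup\{h(x):x\in X\}$. "$X$ has countable scattered height" means that $X$ is scattered and $h(X)$ is a countable ordinal. "$X$ has an $\omega^\omega$-base" means that at each $x\in X$ there is a neighborhood base $(U_f)_{f\in\omega^\omega}$ with $U_f\subseteq U_g$ whenever $g\le f$, where $\omega^\omega$ is the set of sequences of natural numbers ordered by $g\le f$ iff $g(n)\le f(n)$ for all $n$. -/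

import Mathlib

universe u v

open CantorBendixson Topology

/-- A space is scattered if each nonempty subspace `S` has an isolated point, i.e. a point of `S`
that is not an accumulation point of `S`. -/
def IsScattered (X : Type u) [TopologicalSpace X] : Prop :=
  ∀ S : Set X, S.Nonempty → ∃ x ∈ S, ¬ AccPt x (Filter.principal S)

/-- The `a`-th Cantor-Bendixson derivative of `X`:
it is `X` for `a = 0` and `⋂ b < a, (cbDerivative X b)'` for `a > 0`, where `A'` is the set of all
non-isolated points of the subspace `A`. -/
def cbDerivative (X : Type u) [TopologicalSpace X] (a : Ordinal.{u}) : Set X :=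
  iteratedDerivedSet (Set.univ : Set X) a

/-- The height of a point `x` of a scattered space: the ordinal `a` such that `x` lies in the `a`-th
derivative but not in the `(a+1)`-st one
(see `IsScattered.existsUnique_height` for existence and uniqueness). -/
noncomputable def pointHeight {X : Type u} [TopologicalSpace X] (x : X) : Ordinal.{u} :=
  sInf {a | x ∈ cbDerivative X a \ cbDerivative X (a + 1)}

/-- The scattered height of a scattered space, the supremum of the heights of its points. -/
noncomputable def scatteredHeight (X : Type u) [TopologicalSpace X] : Ordinal.{u} :=
  ⨆ x : X, pointHeight x

/-- `X` is scattered and its scattered height is a countable ordinal. -/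
def HasCountableScatteredHeight (X : Type u) [TopologicalSpace X] : Prop :=
  IsScattered X ∧ (scatteredHeight X).card ≤ Cardinal.aleph0

/-- `X` has a `P`-base: at each point `x` there is a neighborhood base `(U p)` indexed by `p : P`
with `U p ⊆ U q` whenever `q ≤ p`. -/
def HasPBase (P : Type v) [Preorder P] (X : Type u) [TopologicalSpace X] : Prop :=
  ∀ x : X, ∃ U : P → Set X, (𝓝 x).HasBasis (fun _ => True) U ∧ Antitone U

theorem cbDerivative_eq (X : Type u) [TopologicalSpace X] (a : Ordinal.{u}) :
    cbDerivative X a = ⋂ b < a, {x ∈ cbDerivative X b | AccPt x (Filter.principal (cbDerivative X b))} := by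
  unfold cbDerivative iteratedDerivedSet
  rw [OrdinalApprox.gfpApprox]
  ext x
  simp [mem_derivedSet, and_comm]

theorem cbDerivative_antitone (X : Type u) [TopologicalSpace X] : Antitone (cbDerivative X) :=
  iteratedDerivedSet_antitone _

theorem IsScattered.exists_cbDerivative_eq_empty {X : Type u} [TopologicalSpace X]
    (hX : IsScattered X) : ∃ a : Ordinal.{u}, cbDerivative X a = ∅ := by
  obtain ⟨a, ha⟩ := iteratedDerivedSet_mem_fixedPoints (Set.univ : Set X)
  refine ⟨a, ?_⟩
  by_contra hne
  obtain ⟨x, hx, hacc⟩ := hX _ (Set.nonempty_iff_ne_empty.mpr hne)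
  have h : x ∈ relDerivedSet (cbDerivative X a) := by
    have e : relDerivedSet (cbDerivative X a) = cbDerivative X a := ha
    rw [e]; exact hx
  exact hacc h.1

theorem IsScattered.existsUnique_height {X : Type u} [TopologicalSpace X]
    (hX : IsScattered X) (x : X) :
    ∃! a : Ordinal.{u}, x ∈ cbDerivative X a \ cbDerivative X (a + 1) := by
  have key : ∃ a : Ordinal.{u}, x ∈ cbDerivative X a \ cbDerivative X (a + 1) := by
    by_contra hno
    push Not at hno
    have hall : ∀ a : Ordinal.{u}, x ∈ cbDerivative X a := by
      intro a
      induction a using WellFoundedLT.induction with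
      | ind a ih =>
        rw [cbDerivative_eq]
        simp only [Set.mem_iInter]
        intro b hb
        have h1 : x ∈ cbDerivative X (b + 1) := by
          by_contra h2
          exact hno b ⟨ih b hb, h2⟩
        rw [cbDerivative_eq] at h1
        simp only [Set.mem_iInter] at h1
        exact h1 b (Order.lt_add_one_iff.mpr le_rfl)
    obtain ⟨a, ha⟩ := hX.exists_cbDerivative_eq_empty
    have := hall a
    simp [ha] at this
  obtain ⟨a, ha⟩ := key
  refine ⟨a, ha, fun b hb => ?_⟩
  rcases lt_trichotomy b a with h | h | h
  · exact absurd (cbDerivative_antitone X (Order.add_one_le_of_lt h) ha.1) hb.2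
  · exact h
  · exact absurd (cbDerivative_antitone X (Order.add_one_le_of_lt h) hb.1) ha.2

/-!
That a countable compact Hausdorff space `X` is metrizable is classical: countably many Urysohn
functions separate its points. Metrizability gives first countability, hence an `ω^ω`-base; the
Baire category theorem, applied to the closure of a nonempty subset, gives scatteredness; and the
heights of the points form an initial segment of the ordinals, which injects into `X`.

For the converse, the combinatorial core is a diagonal argument. Let `K` be a monotone map from
`ω^ω` to sets and write `K(s) = ⋃ {K g | g extends s}` for a finite sequence `s`. If
`x n ∈ K(f ↾ n)` for all `n`, witnessed by `g n`, then the `g n` have a common upper bound `g`, so a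
single `K g` contains every `x n`.

By induction on a countable ordinal `β`, this shows that a monotone family of compact sets `K f`
disjoint from the derivative `X^(β)`, all of whose points have countable open neighborhoods, has a
countable union (`countable_iUnion_of_disjoint_cbDerivative`). By compactness each `K f` meets some
`X^(γ)`, `γ < β`, in a finite set. If for some `f` no `K(f ↾ n)` met any such `X^(γ)` in a finite
set, there would be distinct `x n` such that each `X^(γ)` with `γ < β` contains infinitely many of
them; all of these lie in one `K g`, which is absurd. Hence countably many sets `K(s)` that meet
some `X^(γ)` in a finite set cover the union. For each of them, removing countable open
neighborhoods of these finitely many points leaves a family of compact sets disjoint from `X^(γ)`,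
to which the induction hypothesis applies.

Induction on the height then shows that every point `x` of `X` has a countable open neighborhood:
in a closed neighborhood `V` meeting `X^(h(x))` only in `x`, the complements of the sets of an
`ω^ω`-base at `x` form a family as above. Compactness of `X` finishes the proof.
-/

/-! ### Monotone families indexed by sequences of natural numbers -/

/-- Infinite sets `A 0, A 1, …` have a system of distinct representatives. -/
theorem exists_injective_forall_mem_of_infinite {X : Type*} {A : ℕ → Set X}
    (hA : ∀ n, (A n).Infinite) : ∃ x : ℕ → X, Function.Injective x ∧ ∀ n, x n ∈ A n := by
  classical
  choose t htA htc using fun n => (hA n).exists_subset_card_eq (n + 1)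
  -- Hall's condition holds since the set `t m` with `m = max s` already has `m + 1` elements.
  obtain ⟨x, hx, hxt⟩ := (Finset.all_card_le_biUnion_card_iff_exists_injective t).1 (by
    intro s
    rcases s.eq_empty_or_nonempty with rfl | hs
    · simp
    · calc s.card ≤ (Finset.range (s.max' hs + 1)).card :=
            Finset.card_le_card fun i hi =>
              Finset.mem_range.2 (Nat.lt_succ_of_le (s.le_max' i hi))
        _ = (t (s.max' hs)).card := by simp [htc]
        _ ≤ _ := Finset.card_le_card (Finset.subset_biUnion_of_mem t (s.max'_mem hs)))
  exact ⟨x, hx, fun n => htA n (hxt n)⟩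

/-- The sequence obtained from `g` by replacing its first `s.1` terms by those of the finite
sequence `s`. -/
def overrideInit (s : Σ n, Fin n → ℕ) (g : ℕ → ℕ) : ℕ → ℕ :=
  fun i => if h : i < s.1 then s.2 ⟨i, h⟩ else g i

theorem overrideInit_mono (s : Σ n, Fin n → ℕ) : Monotone (overrideInit s) := by
  intro g g' h i
  unfold overrideInit
  split_ifs
  · exact le_rfl
  · exact h i

/-- The restriction of `f` to its first `n` terms. -/
def initSegment (f : ℕ → ℕ) (n : ℕ) : Σ n, Fin n → ℕ := ⟨n, fun i => f i⟩

theorem overrideInit_initSegment_of_lt (f g : ℕ → ℕ) {n i : ℕ} (h : i < n) :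
    overrideInit (initSegment f n) g i = f i := by
  simp [overrideInit, initSegment, h]

theorem overrideInit_initSegment_self (f : ℕ → ℕ) (n : ℕ) :
    overrideInit (initSegment f n) f = f := by
  ext i
  exact (dite_eq_ite (P := i < n)).trans (ite_self _)

/-- Sequences `g n` extending longer and longer initial segments of a fixed `f` are bounded, since
only finitely many of them differ from `f` at a given place. -/
theorem exists_forall_overrideInit_le (f : ℕ → ℕ) (g : ℕ → ℕ → ℕ) :
    ∃ u : ℕ → ℕ, ∀ n, overrideInit (initSegment f n) (g n) ≤ u := by
  refine ⟨fun i => f i + ∑ n ∈ Finset.range (i + 1), g n i, fun n i => ?_⟩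
  by_cases h : i < n
  · rw [overrideInit_initSegment_of_lt f _ h]
    exact Nat.le_add_right _ _
  · have : g n i ≤ ∑ n ∈ Finset.range (i + 1), g n i :=
      Finset.single_le_sum (f := fun n => g n i) (fun _ _ => Nat.zero_le _)
        (Finset.mem_range.2 (by omega))
    have e : overrideInit (initSegment f n) (g n) i = g n i := dif_neg h
    exact e.le.trans (this.trans (Nat.le_add_left _ _))

theorem exists_forall_mem_of_forall_mem_iUnion_overrideInit {X : Type*} {K : (ℕ → ℕ) → Set X}
    (hK : Monotone K) (f : ℕ → ℕ) {x : ℕ → X}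
    (hx : ∀ n, x n ∈ ⋃ g, K (overrideInit (initSegment f n) g)) : ∃ u, ∀ n, x n ∈ K u := by
  choose g hg using fun n => Set.mem_iUnion.1 (hx n)
  obtain ⟨u, hu⟩ := exists_forall_overrideInit_le f g
  exact ⟨u, fun n => hK (hu n) (hg n)⟩

/-- If every member of a monotone family meets one of the countably many sets `D i` in a finite
set, then along every `f` the union over all extensions of some initial segment of `f` does, too. -/
theorem exists_finite_iUnion_overrideInit_inter {X ι : Type*} [Countable ι] {D : ι → Set X}
    {K : (ℕ → ℕ) → Set X} (hK : Monotone K) (hD : ∀ f, ∃ i, (K f ∩ D i).Finite) (f : ℕ → ℕ) :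
    ∃ n i, ((⋃ g, K (overrideInit (initSegment f n) g)) ∩ D i).Finite := by
  by_contra! hinf
  obtain ⟨i₀, -⟩ := hD f
  have : Nonempty ι := ⟨i₀⟩
  obtain ⟨e, he⟩ := exists_surjective_nat ι
  -- The sequence `n ↦ e n.unpair.1` takes every value in `ι` infinitely often.
  obtain ⟨x, hxinj, hx⟩ :=
    exists_injective_forall_mem_of_infinite fun n => hinf n (e n.unpair.1)
  obtain ⟨u, hu⟩ := exists_forall_mem_of_forall_mem_iUnion_overrideInit hK f fun n => (hx n).1
  obtain ⟨i, hi⟩ := hD u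
  obtain ⟨k, rfl⟩ := he i
  refine Set.infinite_of_injective_forall_mem (f := fun j => x (Nat.pair k j)) ?_ ?_ hi
  · intro j j' h
    exact (Nat.pair_eq_pair.1 (hxinj h)).2
  · intro j
    refine ⟨hu _, ?_⟩
    simpa using (hx (Nat.pair k j)).2

/-! ### Cantor-Bendixson derivatives -/

theorem isClosed_cbDerivative (X : Type u) [TopologicalSpace X] (a : Ordinal.{u}) :
    IsClosed (cbDerivative X a) :=
  isClosed_iteratedDerivedSet isClosed_univ a

theorem mem_cbDerivative_add_one {X : Type u} [TopologicalSpace X] {a : Ordinal.{u}} {x : X} :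
    x ∈ cbDerivative X (a + 1) ↔
      x ∈ cbDerivative X a ∧ AccPt x (Filter.principal (cbDerivative X a)) := by
  simp [cbDerivative, mem_derivedSet, and_comm]

theorem mem_cbDerivative_iff_forall_lt {X : Type u} [TopologicalSpace X] {a : Ordinal.{u}} {x : X} :
    x ∈ cbDerivative X a ↔ ∀ b < a, x ∈ cbDerivative X (b + 1) := by
  rw [cbDerivative_eq]
  simp only [Set.mem_iInter, mem_cbDerivative_add_one]
  rfl

theorem countable_Iio_of_card_le {b : Ordinal.{u}} (hb : b.card ≤ Cardinal.aleph0) :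
    Countable (Set.Iio b) := by
  rw [← Cardinal.mk_le_aleph0_iff, Cardinal.mk_Iio_ordinal, Cardinal.lift_le_aleph0]
  exact hb

/-- A compact set disjoint from `X^(b)` meets an earlier derivative in a finite set: otherwise, for
each `c < b`, it contains an accumulation point of `X^(c)`, and by compactness a common one. -/
theorem IsCompact.exists_finite_inter_cbDerivative {X : Type u} [TopologicalSpace X] {K : Set X}
    (hK : IsCompact K) {b : Ordinal.{u}} (hb : b ≠ 0) (hd : Disjoint K (cbDerivative X b)) :
    ∃ c : Set.Iio b, (K ∩ cbDerivative X c).Finite := by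
  have : Nonempty (Set.Iio b) := ⟨⟨0, pos_iff_ne_zero.2 hb⟩⟩
  obtain ⟨c, hc⟩ := hK.elim_directed_family_closed
    (fun c : Set.Iio b => cbDerivative X (c.1 + 1)) (fun c => isClosed_cbDerivative X _)
    (by
      refine Set.eq_empty_iff_forall_notMem.2 fun x hx => Set.disjoint_left.1 hd hx.1 ?_
      refine mem_cbDerivative_iff_forall_lt.2 fun c hc => ?_
      exact Set.mem_iInter.1 hx.2 ⟨c, hc⟩)
    (Antitone.directed_ge fun c d hcd =>
      cbDerivative_antitone X (add_le_add_left (Subtype.coe_le_coe.2 hcd) 1))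
  refine ⟨c, ?_⟩
  by_contra hinf
  obtain ⟨x, hxK, hx⟩ :=
    Set.Infinite.exists_accPt_of_subset_isCompact hinf hK Set.inter_subset_left
  have hacc : AccPt x (Filter.principal (cbDerivative X c)) :=
    hx.mono (Filter.principal_mono.2 Set.inter_subset_right)
  have hxc : x ∈ cbDerivative X c :=
    (isClosed_iff_derivedSet_subset _).1 (isClosed_cbDerivative X _) hacc
  exact Set.eq_empty_iff_forall_notMem.1 hc x ⟨hxK, mem_cbDerivative_add_one.2 ⟨hxc, hacc⟩⟩

theorem countable_iUnion_of_disjoint_cbDerivative {X : Type u} [TopologicalSpace X]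
    (b : Ordinal.{u}) (hb : b.card ≤ Cardinal.aleph0) (K : (ℕ → ℕ) → Set X) (hK : Monotone K)
    (hc : ∀ f, IsCompact (K f)) (hW : ∀ f, ∀ x ∈ K f, ∃ W, IsOpen W ∧ x ∈ W ∧ W.Countable)
    (hd : ∀ f, Disjoint (K f) (cbDerivative X b)) : (⋃ f, K f).Countable := by
  induction b using WellFoundedLT.induction generalizing K with
  | ind b ih =>
  rcases eq_or_ne b 0 with rfl | hb0
  · have : ∀ f, K f = ∅ := fun f => by simpa [cbDerivative] using hd f
    simp [this]
  have := countable_Iio_of_card_le hb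
  -- The finite sequences `s` for which the union of the `K g` over all `g` extending `s` meets
  -- some earlier derivative in a finite set.
  let S : Set (Σ n, Fin n → ℕ) :=
    {s | ∃ c : Set.Iio b, ((⋃ g, K (overrideInit s g)) ∩ cbDerivative X c).Finite}
  have hcover : (⋃ f, K f) ⊆ ⋃ s ∈ S, ⋃ g, K (overrideInit s g) := by
    refine Set.iUnion_subset fun f => ?_
    obtain ⟨n, c, hfin⟩ := exists_finite_iUnion_overrideInit_inter hK
      (fun f => (hc f).exists_finite_inter_cbDerivative hb0 (hd f)) f
    intro x hx
    refine Set.mem_iUnion₂.2 ⟨initSegment f n, ⟨c, hfin⟩, Set.mem_iUnion.2 ⟨f, ?_⟩⟩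
    rwa [overrideInit_initSegment_self]
  refine (Set.Countable.biUnion S.to_countable ?_).mono hcover
  rintro s ⟨c, hfin⟩
  have hW' : ∀ x ∈ ⋃ g, K (overrideInit s g), ∃ W, IsOpen W ∧ x ∈ W ∧ W.Countable := by
    intro x hx
    obtain ⟨g, hg⟩ := Set.mem_iUnion.1 hx
    exact hW _ x hg
  choose! W hWo hxW hWc using hW'
  set F := (⋃ g, K (overrideInit s g)) ∩ cbDerivative X c
  have hrest : (⋃ g, K (overrideInit s g) \ ⋃ x ∈ F, W x).Countable := by
    refine ih c c.2 ((Ordinal.card_le_card c.2.le).trans hb) _ ?_ ?_ ?_ ?_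
    · exact fun g g' h => Set.sdiff_subset_sdiff_left (hK (overrideInit_mono s h))
    · exact fun g => (hc _).diff (isOpen_biUnion fun x hx => hWo x hx.1)
    · exact fun g x hx => hW _ x hx.1
    · refine fun g => Set.disjoint_left.2 fun x hx hxc => hx.2 ?_
      have hxF : x ∈ F := ⟨Set.mem_iUnion.2 ⟨g, hx.1⟩, hxc⟩
      exact Set.mem_biUnion hxF (hxW x hxF.1)
  refine ((hfin.countable.biUnion fun x hx => hWc x hx.1).union hrest).mono ?_
  rw [← Set.iUnion_sdiff]
  exact fun x hx => (Classical.em _).imp id fun h => ⟨hx, h⟩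

/-! ### Compact spaces with countable scattered height -/

theorem IsScattered.mem_cbDerivative_pointHeight {X : Type u} [TopologicalSpace X]
    (hX : IsScattered X) (x : X) :
    x ∈ cbDerivative X (pointHeight x) \ cbDerivative X (pointHeight x + 1) :=
  csInf_mem (s := {a | x ∈ cbDerivative X a \ cbDerivative X (a + 1)})
    (hX.existsUnique_height x).exists

theorem IsScattered.mem_cbDerivative_iff {X : Type u} [TopologicalSpace X]
    (hX : IsScattered X) {x : X} {a : Ordinal.{u}} :
    x ∈ cbDerivative X a ↔ a ≤ pointHeight x := by
  have hx := hX.mem_cbDerivative_pointHeight x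
  refine ⟨fun h => ?_, fun h => cbDerivative_antitone X h hx.1⟩
  by_contra! hlt
  exact hx.2 (cbDerivative_antitone X (Order.add_one_le_of_lt hlt) h)

theorem exists_countable_open_of_hasPBase {X : Type u} [TopologicalSpace X] [CompactSpace X]
    [T2Space X] (hX : HasCountableScatteredHeight X) (hP : HasPBase (ℕ → ℕ) X) (x : X) :
    ∃ W, IsOpen W ∧ x ∈ W ∧ W.Countable := by
  obtain ⟨hs, hh⟩ := hX
  induction hα : pointHeight x using WellFoundedLT.induction generalizing x with
  | ind α ih =>
  have hx := hs.mem_cbDerivative_pointHeight x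
  have hacc : ¬ AccPt x (Filter.principal (cbDerivative X α)) := fun h =>
    hx.2 (mem_cbDerivative_add_one.2 ⟨hx.1, hα ▸ h⟩)
  rw [accPt_iff_nhds] at hacc
  push Not at hacc
  obtain ⟨O, hO, hOx⟩ := hacc
  obtain ⟨V, hV, hVc, hVO⟩ := exists_mem_nhds_isClosed_subset hO
  obtain ⟨U, hU, hUa⟩ := hP x
  have hcount : (⋃ f, V \ interior (U f)).Countable := by
    refine countable_iUnion_of_disjoint_cbDerivative α ?_ _ ?_ ?_ ?_ ?_
    · exact (Ordinal.card_le_card (hα ▸ Ordinal.le_iSup pointHeight x)).trans hh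
    · exact fun f g h => Set.sdiff_subset_sdiff_right (interior_mono (hUa h))
    · exact fun f => hVc.isCompact.diff isOpen_interior
    all_goals
      have hne : ∀ f, ∀ y ∈ V \ interior (U f), y ∉ cbDerivative X α := by
        intro f y hy hyα
        have hyx := hOx y ⟨hVO hy.1, hyα⟩
        exact hy.2 (hyx ▸ mem_interior_iff_mem_nhds.2 (hU.mem_of_mem trivial))
    · intro f y hy
      refine ih (pointHeight y) ?_ y rfl
      simpa [hs.mem_cbDerivative_iff] using hne f y hy
    · exact fun f => Set.disjoint_left.2 (hne f)
  refine ⟨interior V, isOpen_interior, mem_interior_iff_mem_nhds.2 hV,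
    (hcount.insert x).mono fun y hy => ?_⟩
  by_cases hyx : y = x
  · exact Or.inl hyx
  · obtain ⟨f, -, hf⟩ := hU.mem_iff.1 (isOpen_ne.mem_nhds (Ne.symm hyx))
    exact Or.inr (Set.mem_iUnion.2
      ⟨f, interior_subset hy, fun h => hf (interior_subset h) rfl⟩)

theorem countable_of_hasPBase {X : Type u} [TopologicalSpace X] [CompactSpace X]
    [T2Space X] (hX : HasCountableScatteredHeight X) (hP : HasPBase (ℕ → ℕ) X) : Countable X := by
  choose W hWo hxW hWc using exists_countable_open_of_hasPBase hX hP
  obtain ⟨t, ht⟩ := isCompact_univ.elim_finite_subcover W hWo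
    fun x _ => Set.mem_iUnion.2 ⟨x, hxW x⟩
  exact Set.countable_univ_iff.1 ((t.countable_toSet.biUnion fun x _ => hWc x).mono ht)

/-! ### Countable compact spaces -/

theorem metrizableSpace_of_countable_of_compactSpace (X : Type*) [TopologicalSpace X]
    [CompactSpace X] [T2Space X] [Countable X] : TopologicalSpace.MetrizableSpace X := by
  have := Encodable.ofCountable {p : X × X // p.1 ≠ p.2}
  choose φ h₀ h₁ using fun p : {p : X × X // p.1 ≠ p.2} =>
    exists_continuous_zero_one_of_isClosed (isClosed_singleton (x := p.1.1))
      (isClosed_singleton (x := p.1.2)) (Set.disjoint_singleton.2 p.2)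
  refine Metric.PiNatEmbed.TopologicalSpace.MetrizableSpace.of_countable_separating (fun p x => φ p x)
    (fun p => (φ p).continuous) fun x y hxy => ⟨⟨(x, y), hxy⟩, ?_⟩
  have e₀ : φ ⟨(x, y), hxy⟩ x = 0 := h₀ ⟨(x, y), hxy⟩ rfl
  have e₁ : φ ⟨(x, y), hxy⟩ y = 1 := (h₁ ⟨(x, y), hxy⟩).1 rfl
  simp [e₀, e₁]

theorem isScattered_of_countable (X : Type u) [TopologicalSpace X] [CompactSpace X]
    [T2Space X] [Countable X] : IsScattered X := by
  intro S hS
  let C := closure S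
  have : CompactSpace C := isCompact_iff_compactSpace.1 isClosed_closure.isCompact
  have : Nonempty C := hS.closure.to_subtype
  -- By Baire category some singleton of the countable space `C` is open; by density it meets `S`.
  obtain ⟨x, hx⟩ := nonempty_interior_of_iUnion_of_closed (f := fun x : C => {x})
    (fun _ => isClosed_singleton) (Set.iUnion_of_singleton C)
  obtain ⟨O, hO, hOx⟩ := isOpen_induced_iff.1 (interior_eq_iff_isOpen.1
    ((Set.subset_singleton_iff_eq.1 interior_subset).resolve_left hx.ne_empty))
  have hxO : (x : X) ∈ O := by
    have : x ∈ Subtype.val ⁻¹' O := hOx ▸ Set.mem_singleton x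
    exact this
  have huniq : ∀ y ∈ O ∩ S, y = x := fun y hy => by
    have : (⟨y, subset_closure hy.2⟩ : C) ∈ Subtype.val ⁻¹' O := hy.1
    rw [hOx] at this
    exact congrArg Subtype.val this
  obtain ⟨y, hyO, hyS⟩ := mem_closure_iff.1 x.2 O hO hxO
  refine ⟨y, hyS, fun hacc => ?_⟩
  obtain ⟨z, hz, hzy⟩ := accPt_iff_nhds.1 hacc O (hO.mem_nhds hyO)
  exact hzy ((huniq z hz).trans (huniq y ⟨hyO, hyS⟩).symm)

/-- Every ordinal below the height of a point is itself the height of a point. -/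
theorem IsScattered.exists_pointHeight_eq {X : Type u} [TopologicalSpace X] (hX : IsScattered X)
    {a : Ordinal.{u}} {x : X} (ha : a < pointHeight x) : ∃ y : X, pointHeight y = a := by
  obtain ⟨y, hy, hacc⟩ := hX (cbDerivative X a) ⟨x, hX.mem_cbDerivative_iff.2 ha.le⟩
  refine ⟨y, le_antisymm ?_ (hX.mem_cbDerivative_iff.1 hy)⟩
  by_contra! hlt
  exact hacc (mem_cbDerivative_add_one.1
    (hX.mem_cbDerivative_iff.2 (Order.add_one_le_of_lt hlt))).2

theorem IsScattered.card_scatteredHeight_le {X : Type u} [TopologicalSpace X]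
    (hX : IsScattered X) : (scatteredHeight X).card ≤ Cardinal.mk X := by
  have hex : ∀ a : Set.Iio (scatteredHeight X), ∃ y : X, pointHeight y = a := fun a => by
    obtain ⟨x, hx⟩ := Ordinal.lt_iSup_iff.1 a.2
    exact hX.exists_pointHeight_eq hx
  choose y hy using hex
  have hinj : Function.Injective y := fun a b h => Subtype.ext (by rw [← hy a, ← hy b, h])
  have := Cardinal.mk_le_of_injective (α := ULift.{u + 1} (Set.Iio (scatteredHeight X)))
    (β := ULift.{u + 1} X) (f := fun a => ⟨y a.down⟩)
    fun a b h => ULift.ext _ _ (hinj (congrArg ULift.down h))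
  rwa [Cardinal.mk_uLift, Cardinal.mk_uLift, Cardinal.mk_Iio_ordinal, Cardinal.lift_lift,
    Cardinal.lift_le] at this

theorem hasPBase_of_firstCountableTopology (X : Type u) [TopologicalSpace X]
    [FirstCountableTopology X] : HasPBase (ℕ → ℕ) X := by
  intro x
  obtain ⟨B, hB⟩ := (nhds x).exists_antitone_basis
  refine ⟨fun f => B (f 0), ⟨fun t => ?_⟩, fun f g h => hB.antitone (h 0)⟩
  rw [hB.mem_iff]
  exact ⟨fun ⟨n, hn⟩ => ⟨fun _ => n, trivial, hn⟩, fun ⟨f, _, hf⟩ => ⟨f 0, hf⟩⟩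

theorem mainTheorem2 (X : Type u) [TopologicalSpace X] [CompactSpace X] [T2Space X] :
    (Countable X ↔ HasCountableScatteredHeight X ∧ HasPBase (ℕ → ℕ) X) ∧
      (Countable X → TopologicalSpace.MetrizableSpace X) := by
  refine ⟨⟨fun _ => ?_, fun h => countable_of_hasPBase h.1 h.2⟩,
    fun _ => metrizableSpace_of_countable_of_compactSpace X⟩
  have := metrizableSpace_of_countable_of_compactSpace X
  have hs := isScattered_of_countable X
  exact ⟨⟨hs, hs.card_scatteredHeight_le.trans Cardinal.mk_le_aleph0⟩,
    hasPBase_of_firstCountableTopology X⟩
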